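/- Let $G$ be a finitely generated nilpotent group. Then $G$ is infinite if and only if there is a proper left-invariant metric $d$ on $G$ such that $\operatorname{asdim}_{AN}(G,d)=\infty$. Here a metric $d$ on $G$ is *proper left-invariant* if $d(g_1g_2,g_1g_3)=d(g_2,g_3)$ for all $g_1,g_2,g_3\in G$, and for every $K>0$ the set $\{g\in G: d(1,g)\le K\}$ is finite. For a metric space $(X,d)$ and an integer $n\ge 0$, $\operatorname{asdim}_{AN}(X,d)\le n$ means that there are constants $C>0$ and $k\geq 0$ such that for every $s>0$ the space $X$ is covered by $n+1$ subsets $U_0,\dots,U_n$ for which every $s$-scale connected component of each $U_i$ has diameter at most $Cs+k$. Two points $x,y\in U_i$ lie in the same $s$-scale connected component of $U_i$ if there is a finite sequence $x=x_0,x_1,\dots,x_m=y$ of points of $U_i$ with $d(x_j,x_{j+1})<s$ for all $0\le j<m$. The asymptotic Assouad–Nagata dimension $\operatorname{asdim}_{AN}(X,d)$ is the least such $n$, and it is $\infty$ if there is none. -/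

import Mathlib

open scoped NNReal

/-- `x` and `y` are joined by an `s`-scale chain `x = p 0, p 1, …, p m = y` contained in `S`:
consecutive points are at distance `< s`. -/
def ScaleJoinedIn {X : Type*} [MetricSpace X] (s : ℝ) (S : Set X) (x y : X) : Prop :=
  ∃ (m : ℕ) (p : ℕ → X), p 0 = x ∧ p m = y ∧ (∀ i ≤ m, p i ∈ S) ∧
    ∀ i < m, dist (p i) (p (i + 1)) < s

/-- The `s`-scale connected component of the point `x` in the subset `S` of a metric space. -/
def scaleComponent {X : Type*} [MetricSpace X] (s : ℝ) (S : Set X) (x : X) : Set X :=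
  {y | ScaleJoinedIn s S x y}

/-- `D` is an `n`-dimensional control function for `X`: it is increasing, and for every `s > 0` the
space is covered by `n + 1` sets all of whose `s`-scale connected components have diameter at most
`D s`. -/
def IsControlFunction (X : Type*) [MetricSpace X] (n : ℕ) (D : ℝ≥0 → ℝ≥0) : Prop :=
  Monotone D ∧ ∀ s : ℝ≥0, 0 < s → ∃ U : Fin (n + 1) → Set X,
    (⋃ i, U i) = Set.univ ∧
    ∀ i, ∀ x ∈ U i, ∀ y ∈ scaleComponent s (U i) x, ∀ z ∈ scaleComponent s (U i) x,
      dist y z ≤ D s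

/-- `X` has asymptotic Assouad–Nagata dimension at most `n`: it has an `n`-dimensional control
function of the form `D s = C * s + k`, with constants `C > 0` and `k`. -/
def AsdimANLE (X : Type*) [MetricSpace X] (n : ℕ) : Prop :=
  ∃ D : ℝ≥0 → ℝ≥0, IsControlFunction X n D ∧
    ∃ C k : ℝ, 0 < C ∧ ∀ s : ℝ≥0, (D s : ℝ) = C * s + k

/-- The asymptotic Assouad–Nagata dimension of `X`: the least `n` with `AsdimANLE X n`, and `⊤` if
there is none. -/
noncomputable def asdimAN (X : Type*) [MetricSpace X] : ℕ∞ :=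
  ⨅ (n : ℕ) (_ : AsdimANLE X n), (n : ℕ∞)

/-- The given metric on the group `G` is a proper left-invariant metric. -/
structure IsProperLeftInvariantMetric (G : Type*) [Group G] [MetricSpace G] : Prop where
  left_invariant : ∀ g₁ g₂ g₃ : G, dist (g₁ * g₂) (g₁ * g₃) = dist g₂ g₃
  proper : ∀ K : ℝ, 0 < K → {g : G | dist 1 g ≤ K}.Finite

/-! A finite group is a single bounded piece, hence of dimension 0. An infinite finitely generated
nilpotent group has infinite abelianization, so it maps onto `ℤ` by some `φ`; let `t` be sent to
`1`. Take the word metric in which `t ^ (±3 ^ j)` costs only `j + 1` and all other elements are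
expensive (`ternaryWeight`).

The points `t ^ ∑ aᵢ 3 ^ (m + i)` with `aᵢ ∈ {0, 1}`, `i < m`, then form an `m`-cube whose metric is
the Hamming metric scaled by about `m`. The upper bound multiplies the digits out; the lower bound
pulls back along `φ` a seminorm on `ℤ` that lies below the weights and counts balanced ternary
digits (`blockSeminorm`).

A linear control function would color such cubes with `n + 1` colors so that the monochromatic
2-step components have Hamming diameter at most `R`, with `R` independent of `m`. A double count
(`dimension_le_of_components_bounded`) forces `m ≤ (n + 1) * (2 * R + 1)`, which fails for large
`m`. -/

/-! ### Proper left-invariant metrics from weights. -/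

section WeightedLength

variable {G : Type*} [Group G]

/-- The least total weight of a list of elements of `G` with product `g`. -/
noncomputable def weightedLength (W : G → ℕ) (g : G) : ℕ :=
  sInf {n | ∃ l : List G, l.prod = g ∧ (l.map W).sum = n}

theorem exists_list_weightedLength (W : G → ℕ) (g : G) :
    ∃ l : List G, l.prod = g ∧ (l.map W).sum = weightedLength W g :=
  Nat.sInf_mem (s := {n | ∃ l : List G, l.prod = g ∧ (l.map W).sum = n})
    ⟨W g, [g], by simp⟩

theorem weightedLength_prod_le (W : G → ℕ) (l : List G) :
    weightedLength W l.prod ≤ (l.map W).sum :=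
  Nat.sInf_le ⟨l, rfl, rfl⟩

theorem weightedLength_le (W : G → ℕ) (g : G) : weightedLength W g ≤ W g := by
  simpa using weightedLength_prod_le W [g]

@[simp]
theorem weightedLength_one (W : G → ℕ) : weightedLength W 1 = 0 := by
  simpa using weightedLength_prod_le W []

theorem weightedLength_mul_le (W : G → ℕ) (g h : G) :
    weightedLength W (g * h) ≤ weightedLength W g + weightedLength W h := by
  obtain ⟨l, rfl, hl⟩ := exists_list_weightedLength W g
  obtain ⟨l', rfl, hl'⟩ := exists_list_weightedLength W h
  rw [← hl, ← hl', ← List.prod_append, ← List.sum_append, ← List.map_append]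
  exact weightedLength_prod_le W _

theorem weightedLength_inv_le {W : G → ℕ} (hW : ∀ g, W g⁻¹ = W g) (g : G) :
    weightedLength W g⁻¹ ≤ weightedLength W g := by
  obtain ⟨l, rfl, hl⟩ := exists_list_weightedLength W g
  rw [← hl, List.prod_inv_reverse]
  refine (weightedLength_prod_le W _).trans (le_of_eq ?_)
  rw [List.map_reverse, List.sum_reverse, List.map_map]
  congr 2
  exact funext hW

theorem weightedLength_inv {W : G → ℕ} (hW : ∀ g, W g⁻¹ = W g) (g : G) :
    weightedLength W g⁻¹ = weightedLength W g :=
  le_antisymm (weightedLength_inv_le hW g) (by simpa using weightedLength_inv_le hW g⁻¹)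

/-- The source of lower bounds on the metric: `weightedLength W` dominates every subadditive
function below `W`. -/
theorem le_weightedLength {W : G → ℕ} {F : G → ℝ} (h1 : F 1 ≤ 0)
    (hmul : ∀ g h, F (g * h) ≤ F g + F h) (hFW : ∀ g, F g ≤ W g) (g : G) :
    F g ≤ weightedLength W g := by
  obtain ⟨l, rfl, hl⟩ := exists_list_weightedLength W g
  rw [← hl]
  clear hl
  induction l with
  | nil => simpa using h1
  | cons a l ih =>
    have h2 := hmul a l.prod
    have h3 := hFW a
    simp only [List.prod_cons, List.map_cons, List.sum_cons, Nat.cast_add]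
    linarith

theorem eq_one_of_weightedLength_eq_zero {W : G → ℕ} (hpos : ∀ g, 0 < W g) {g : G}
    (hg : weightedLength W g = 0) : g = 1 := by
  obtain ⟨l, rfl, hl⟩ := exists_list_weightedLength W g
  cases l with
  | nil => rfl
  | cons a l =>
    have := hpos a
    simp only [List.map_cons, List.sum_cons] at hl
    omega

theorem finite_setOf_weightedLength_le {W : G → ℕ} (hpos : ∀ g, 0 < W g)
    (hfin : ∀ K, {g | W g ≤ K}.Finite) (K : ℕ) : {g | weightedLength W g ≤ K}.Finite := by
  induction K with
  | zero =>
    refine (Set.finite_singleton (1 : G)).subset fun g hg => ?_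
    exact eq_one_of_weightedLength_eq_zero hpos (Nat.le_zero.mp hg)
  | succ K ih =>
    -- Each letter weighs at least 1, so removing the first one leaves a product of length at most
    -- `K`.
    refine (((hfin (K + 1)).image2 (fun a b => a * b) ih).insert 1).subset fun g hg => ?_
    obtain ⟨l, rfl, hl⟩ := exists_list_weightedLength W g
    cases l with
    | nil => simp
    | cons a l =>
      have h1 := hpos a
      have h2 := weightedLength_prod_le W l
      simp only [Set.mem_ofPred_eq, ← hl, List.map_cons, List.sum_cons] at hg
      refine Or.inr ⟨a, ?_, l.prod, ?_, by simp⟩ <;> simp only [Set.mem_ofPred_eq] <;> omega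

/-- The left-invariant metric with `dist g h` the weighted length of `g⁻¹ * h`. -/
@[reducible]
noncomputable def weightedLengthMetric (W : G → ℕ) (hW : ∀ g, W g⁻¹ = W g)
    (hpos : ∀ g, 0 < W g) : MetricSpace G where
  dist g h := weightedLength W (g⁻¹ * h)
  dist_self g := by simp
  dist_comm g h := by
    rw [← weightedLength_inv hW (g⁻¹ * h)]
    simp
  dist_triangle g h k := by
    have := weightedLength_mul_le W (g⁻¹ * h) (h⁻¹ * k)
    rw [show g⁻¹ * h * (h⁻¹ * k) = g⁻¹ * k by group] at this
    exact_mod_cast this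
  eq_of_dist_eq_zero {g h} hgh := by
    have := eq_one_of_weightedLength_eq_zero hpos (Nat.cast_eq_zero.mp hgh)
    rwa [inv_mul_eq_one] at this

theorem isProperLeftInvariantMetric_weightedLengthMetric {W : G → ℕ} (hW : ∀ g, W g⁻¹ = W g)
    (hpos : ∀ g, 0 < W g) (hfin : ∀ K, {g | W g ≤ K}.Finite) :
    @IsProperLeftInvariantMetric G _ (weightedLengthMetric W hW hpos) := by
  let _ := weightedLengthMetric W hW hpos
  refine ⟨fun g₁ g₂ g₃ => ?_, fun K _ => ?_⟩
  · change ((weightedLength W _ : ℕ) : ℝ) = (weightedLength W _ : ℕ)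
    congr 2
    group
  · refine (finite_setOf_weightedLength_le hpos hfin ⌊K⌋₊).subset fun g hg => ?_
    have : ((weightedLength W (1⁻¹ * g) : ℕ) : ℝ) ≤ K := hg
    rw [inv_one, one_mul] at this
    exact Nat.le_floor this

end WeightedLength

/-! ### Infinite finitely generated nilpotent groups map onto `ℤ`. -/

section Nilpotent

/-- A commutator depends only on the classes of its entries modulo the center, so there are finitely
many; by Schur's theorem the commutator subgroup is then finite. -/
theorem finite_of_finite_quotient_center_of_finite_abelianization (G : Type*) [Group G]
    [Finite (G ⧸ Subgroup.center G)] [Finite (Abelianization G)] : Finite G := by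
  have hset : Finite (commutatorSet G) := by
    refine Set.Finite.subset (Set.finite_range
      fun p : (G ⧸ Subgroup.center G) × (G ⧸ Subgroup.center G) =>
        p.1.out * p.2.out * p.1.out⁻¹ * p.2.out⁻¹) ?_
    rintro _ ⟨g, h, rfl⟩
    refine ⟨(g, h), ?_⟩
    obtain ⟨⟨z, hz⟩, hz'⟩ := QuotientGroup.mk_out_eq_mul (Subgroup.center G) g
    obtain ⟨⟨w, hw⟩, hw'⟩ := QuotientGroup.mk_out_eq_mul (Subgroup.center G) h
    simp only [hz', hw']
    rw [Subgroup.mem_center_iff] at hz hw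
    simp only [commutatorElement_def, mul_inv_rev]
    have e1 : g * z * (h * w) = g * h * w * z := by
      rw [mul_assoc g z, ← hz (h * w)]; group
    calc g * z * (h * w) * (z⁻¹ * g⁻¹) * (w⁻¹ * h⁻¹)
        = g * h * w * g⁻¹ * w⁻¹ * h⁻¹ := by rw [e1]; group
      _ = g * h * (g⁻¹ * w) * w⁻¹ * h⁻¹ := by rw [hw g⁻¹]; group
      _ = g * h * g⁻¹ * h⁻¹ := by group
  have : Finite (commutator G) := inferInstance
  have h2 : Finite (G ⧸ commutator G) := ‹Finite (Abelianization G)›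
  exact Finite.of_equiv _ (Subgroup.groupEquivQuotientProdSubgroup (s := commutator G)).symm

theorem Group.IsNilpotent.finite_of_finite_abelianization (G : Type*) [Group G]
    [Group.IsNilpotent G] (h : Finite (Abelianization G)) : Finite G := by
  revert h
  refine Group.nilpotent_center_quotient_ind
    (P := fun G [Group G] [Group.IsNilpotent G] => Finite (Abelianization G) → Finite G) G ?_ ?_
  · intro G _ _ _
    infer_instance
  · intro G _ _ ih h
    have : Finite (Abelianization (G ⧸ Subgroup.center G)) := by
      refine Finite.of_surjective (Abelianization.map (QuotientGroup.mk' (Subgroup.center G))) ?_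
      intro x
      obtain ⟨y, rfl⟩ := QuotientGroup.mk_surjective x
      obtain ⟨z, rfl⟩ := QuotientGroup.mk_surjective y
      exact ⟨Abelianization.of z, rfl⟩
    have := ih this
    exact finite_of_finite_quotient_center_of_finite_abelianization G

theorem CommGroup.exists_surjective_int (A : Type*) [CommGroup A] [Group.FG A] [Infinite A] :
    ∃ φ : A →* Multiplicative ℤ, Function.Surjective φ := by
  obtain ⟨ι, j, _, _, p, hp, e, ⟨f⟩⟩ := CommGroup.equiv_free_prod_prod_multiplicative_zmod A
  have : ∀ i, NeZero (p i ^ e i) := fun i => ⟨pow_ne_zero _ (hp i).ne_zero⟩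
  have : ∀ i, Finite (Multiplicative (ZMod (p i ^ e i))) := fun i =>
    inferInstanceAs (Finite (ZMod (p i ^ e i)))
  rcases isEmpty_or_nonempty j with hj | ⟨⟨k⟩⟩
  · exact (not_finite_iff_infinite.mpr ‹Infinite A› (Finite.of_equiv _ f.symm.toEquiv)).elim
  · refine ⟨((Pi.evalMonoidHom _ k).comp (MonoidHom.fst _ _)).comp f.toMonoidHom, fun x => ?_⟩
    exact ⟨f.symm (fun _ => x, 1), by simp⟩

theorem Group.IsNilpotent.exists_surjective_int (G : Type*) [Group G] [Group.FG G]
    [Group.IsNilpotent G] [Infinite G] : ∃ φ : G →* Multiplicative ℤ, Function.Surjective φ := by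
  have : Group.FG (Abelianization G) :=
    Group.fg_of_surjective (f := (Abelianization.of : G →* Abelianization G))
      QuotientGroup.mk_surjective
  have : Infinite (Abelianization G) := not_finite_iff_infinite.mp fun h =>
    not_finite_iff_infinite.mpr ‹_› (Group.IsNilpotent.finite_of_finite_abelianization G h)
  obtain ⟨φ, hφ⟩ := CommGroup.exists_surjective_int (Abelianization G)
  exact ⟨φ.comp Abelianization.of, hφ.comp QuotientGroup.mk_surjective⟩

theorem Group.FG.countable (G : Type*) [Group G] [Group.FG G] : Countable G := by
  obtain ⟨α, _, φ, hφ⟩ := Group.fg_iff_exists_freeGroup_hom_surjective_finite.mp ‹Group.FG G›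
  have : Countable (FreeGroup α) := Quot.mk_surjective.countable
  exact hφ.countable

end Nilpotent

/-! ### Colorings of the Hamming cube. -/

section ColoredCube

variable {m : ℕ}

/-- The vertex of the cube obtained from `a` by changing the coordinate `i`. -/
def flipCoord (a : Fin m → Bool) (i : Fin m) : Fin m → Bool := Function.update a i (!a i)

theorem hammingDist_flipCoord_le (a : Fin m → Bool) (i : Fin m) :
    hammingDist a (flipCoord a i) ≤ 1 := by
  refine (Finset.card_le_card (t := {i}) fun j hj => ?_).trans (by simp)
  by_contra h
  rw [Finset.mem_singleton] at h
  exact (Finset.mem_filter.mp hj).2 (by simp [flipCoord, Function.update_of_ne h])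

theorem flipCoord_injective_left (i : Fin m) :
    Function.Injective fun a : Fin m → Bool => flipCoord a i := by
  refine Function.LeftInverse.injective (g := fun a => flipCoord a i) fun a => ?_
  simp [flipCoord]

/-- Two vertices of the same color at Hamming distance at most `2`. -/
def ColorStep {α : Type*} (c : (Fin m → Bool) → α) (a b : Fin m → Bool) : Prop :=
  c a = c b ∧ hammingDist a b ≤ 2

theorem colorStep_symm {α : Type*} (c : (Fin m → Bool) → α) : Std.Symm (ColorStep c) :=
  ⟨fun _ _ h => ⟨h.1.symm, by rw [hammingDist_comm]; exact h.2⟩⟩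

/-- The vertices joined to each other by monochromatic chains with steps of length at most `2`. -/
def colorSetoid {α : Type*} (c : (Fin m → Bool) → α) : Setoid (Fin m → Bool) where
  r := Relation.ReflTransGen (ColorStep c)
  iseqv :=
    ⟨fun _ => Relation.ReflTransGen.refl,
      fun h => (@Relation.ReflTransGen.stdSymm _ _ (colorStep_symm c)).symm _ _ h,
      fun h h' => h.trans h'⟩

-- Neighbors of `a` are pairwise within distance 2, so all those of the most frequent color share a
-- component.
open Classical in
theorem exists_popular_component {n : ℕ} (c : (Fin m → Bool) → Fin (n + 1))
    (a : Fin m → Bool) : ∃ q : Quotient (colorSetoid c),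
      m ≤ (n + 1) *
        (Finset.univ.filter fun i => Quotient.mk (colorSetoid c) (flipCoord a i) = q).card := by
  rcases Nat.eq_zero_or_pos m with rfl | hm
  · exact ⟨Quotient.mk _ a, by simp⟩
  let f : Fin (n + 1) → Finset (Fin m) := fun y => {i | c (flipCoord a i) = y}
  obtain ⟨y, -, hy⟩ := Finset.exists_max_image Finset.univ (fun y => (f y).card)
    Finset.univ_nonempty
  have hm' : m ≤ (n + 1) * (f y).card := by
    calc m = ∑ y', (f y').card := by
          simpa using Finset.card_eq_sum_card_fiberwise (f := fun i => c (flipCoord a i))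
            (s := (Finset.univ : Finset (Fin m))) (t := Finset.univ) (by simp)
      _ ≤ ∑ _y' : Fin (n + 1), (f y).card := Finset.sum_le_sum fun y' _ => hy y' (by simp)
      _ = (n + 1) * (f y).card := by simp
  have hne : (f y).Nonempty := by
    rw [Finset.nonempty_iff_ne_empty]
    intro h
    rw [h] at hm'
    simp at hm'
    omega
  obtain ⟨i₀, hi₀⟩ := hne
  refine ⟨Quotient.mk _ (flipCoord a i₀), hm'.trans ?_⟩
  gcongr
  intro i hi
  simp only [f, Finset.mem_filter, Finset.mem_univ, true_and] at hi hi₀ ⊢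
  refine Quotient.sound (Relation.ReflTransGen.single ⟨hi.trans hi₀.symm, ?_⟩)
  have h1 := hammingDist_triangle (flipCoord a i) a (flipCoord a i₀)
  have h2 := hammingDist_flipCoord_le a i
  have h3 := hammingDist_flipCoord_le a i₀
  rw [hammingDist_comm] at h2
  omega

/-- Each vertex has at least `m / (n + 1)` neighbors in one component. Comparing them with a fixed
representative of that component bounds their number, on average over the cube, by `2 * R + 1`. -/
theorem dimension_le_of_components_bounded {n R : ℕ} (c : (Fin m → Bool) → Fin (n + 1))
    (hR : ∀ a b, Relation.ReflTransGen (ColorStep c) a b → hammingDist a b ≤ R) :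
    m ≤ (n + 1) * (2 * R + 1) := by
  classical
  choose q hq using exists_popular_component c
  let rep : (Fin m → Bool) → Fin m → Bool := fun a => (Quotient.mk (colorSetoid c) a).out
  have hrep : ∀ a, hammingDist a (rep a) ≤ R := fun a =>
    hR _ _ ((colorSetoid c).symm (@Quotient.mk_out _ (colorSetoid c) a))
  let B : (Fin m → Bool) → Fin m → ℕ := fun a i => if a i ≠ rep a i then 1 else 0
  have hB : ∀ a, ∑ i, B a i ≤ R := fun a => by
    simp only [B, ← Finset.card_filter]
    exact hrep a
  have hsum : ∑ a, ∑ i, B (flipCoord a i) i ≤ 2 ^ m * R := by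
    rw [Finset.sum_comm]
    -- Flipping coordinate `i` permutes the vertices.
    have : ∀ i, ∑ a, B (flipCoord a i) i = ∑ a, B a i := fun i =>
      (Finite.injective_iff_bijective.mp (flipCoord_injective_left i)).sum_comp fun a => B a i
    simp_rw [this]
    rw [Finset.sum_comm]
    exact (Finset.sum_le_sum fun a _ => hB a).trans (by simp)
  have hcard : ∀ a, (Finset.univ.filter fun i =>
      Quotient.mk (colorSetoid c) (flipCoord a i) = q a).card ≤
        (R + 1) + ∑ i, B (flipCoord a i) i := by
    intro a
    set T := Finset.univ.filter fun i => Quotient.mk (colorSetoid c) (flipCoord a i) = q a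
      with hT
    rcases T.eq_empty_or_nonempty with h | ⟨i₀, hi₀⟩
    · simp [h]
    have hq' : hammingDist a (q a).out ≤ R + 1 := by
      have h1 := hammingDist_triangle a (flipCoord a i₀) (q a).out
      have h2 := hammingDist_flipCoord_le a i₀
      have h3 := hrep (flipCoord a i₀)
      rw [hT, Finset.mem_filter] at hi₀
      simp only [rep, hi₀.2] at h3
      omega
    calc T.card = ∑ i ∈ T, 1 := by simp
      -- `a` and its `i`-th neighbor differ at `i`, so one of them disagrees there with the common
      -- representative.
      _ ≤ ∑ i ∈ T, ((if a i ≠ (q a).out i then 1 else 0) + B (flipCoord a i) i) := by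
          refine Finset.sum_le_sum fun i hi => ?_
          rw [hT, Finset.mem_filter] at hi
          simp only [B, rep, hi.2]
          simp only [flipCoord, Function.update_self]
          cases a i <;> cases (q a).out i <;> simp
      _ ≤ ∑ i, ((if a i ≠ (q a).out i then 1 else 0) + B (flipCoord a i) i) :=
          Finset.sum_le_sum_of_subset (Finset.subset_univ _)
      _ = hammingDist a (q a).out + ∑ i, B (flipCoord a i) i := by
          rw [Finset.sum_add_distrib, ← Finset.card_filter]
          rfl
      _ ≤ _ := by gcongr
  have htotal : 2 ^ m * m ≤ 2 ^ m * ((n + 1) * (2 * R + 1)) := by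
    calc 2 ^ m * m = ∑ _a : Fin m → Bool, m := by simp
      _ ≤ ∑ a : Fin m → Bool, (n + 1) * ((R + 1) + ∑ i, B (flipCoord a i) i) :=
          Finset.sum_le_sum fun a _ => (hq a).trans (Nat.mul_le_mul_left _ (hcard a))
      _ = (n + 1) * (2 ^ m * (R + 1) + ∑ a, ∑ i, B (flipCoord a i) i) := by
          simp [← Finset.mul_sum, Finset.sum_add_distrib]
      _ ≤ (n + 1) * (2 ^ m * (R + 1) + 2 ^ m * R) := by gcongr
      _ = _ := by ring
  exact Nat.le_of_mul_le_mul_left htotal (by positivity)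

end ColoredCube

/-! ### From cubes to infinite dimension. -/

section AsymptoticDimension

variable {X : Type*} [MetricSpace X]

theorem ScaleJoinedIn.refl {s : ℝ} {S : Set X} {x : X} (hx : x ∈ S) : ScaleJoinedIn s S x x :=
  ⟨0, fun _ => x, rfl, rfl, fun _ _ => hx, fun _ h => absurd h (Nat.not_lt_zero _)⟩

theorem ScaleJoinedIn.tail {s : ℝ} {S : Set X} {x y z : X} (h : ScaleJoinedIn s S x y)
    (hz : z ∈ S) (hyz : dist y z < s) : ScaleJoinedIn s S x z := by
  obtain ⟨m, p, rfl, rfl, hp, hd⟩ := h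
  refine ⟨m + 1, fun i => if i ≤ m then p i else z, by simp, by simp, fun i _ => ?_, fun i hi => ?_⟩
  · dsimp only
    split_ifs with h
    exacts [hp i h, hz]
  · rcases Nat.lt_succ_iff_lt_or_eq.mp hi with h | rfl
    · simpa [h.le, Nat.succ_le_iff.mpr h] using hd i h
    · simpa using hyz

/-- A space containing Hamming cubes of all dimensions, with metrics rescaled arbitrarily up to
uniform constants, has no finite asymptotic Assouad–Nagata dimension. -/
theorem not_asdimANLE_of_cubes
    (hX : ∀ m : ℕ, ∃ f : (Fin m → Bool) → X, ∀ a b,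
      (m + 1 : ℝ) / 6 * hammingDist a b ≤ dist (f a) (f b) ∧
        dist (f a) (f b) ≤ 2 * m * hammingDist a b) (n : ℕ) : ¬ AsdimANLE X n := by
  rintro ⟨D, ⟨-, hD⟩, C, k, hC, hDC⟩
  -- Dividing `C * (4 * m + 1) + k` by the lower scaling factor `(m + 1) / 6` gives at most this,
  -- whatever `m` is.
  set R := ⌈24 * C + 6 * |k|⌉₊ with hR
  set m := (n + 1) * (2 * R + 1) + 1 with hm
  obtain ⟨f, hf⟩ := hX m
  -- A color step has length at most `2 * m * 2`; the extra 1 makes the inequality strict.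
  obtain ⟨U, hU, hUD⟩ := hD (4 * m + 1) (by positivity)
  have hmem : ∀ a, ∃ i, f a ∈ U i := fun a => Set.mem_iUnion.mp (hU ▸ Set.mem_univ (f a))
  choose c hc using hmem
  have hjoin : ∀ a b, Relation.ReflTransGen (ColorStep c) a b →
      c b = c a ∧ ScaleJoinedIn ((4 * m + 1 : ℝ≥0) : ℝ) (U (c a)) (f a) (f b) := by
    intro a b hab
    induction hab with
    | refl => exact ⟨rfl, ScaleJoinedIn.refl (hc a)⟩
    | tail _ hstep ih =>
      refine ⟨hstep.1.symm.trans ih.1, ih.2.tail ?_ ?_⟩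
      · rw [← ih.1, hstep.1]
        exact hc _
      · refine (hf _ _).2.trans_lt ?_
        have : (hammingDist _ _ : ℝ) ≤ 2 := Nat.cast_le.mpr hstep.2
        push_cast
        have hm0 : (0 : ℝ) ≤ m := Nat.cast_nonneg m
        nlinarith
  have hle : m ≤ (n + 1) * (2 * R + 1) := by
    refine dimension_le_of_components_bounded c fun a b hab => ?_
    have h1 := hUD (c a) (f a) (hc a) (f a) (ScaleJoinedIn.refl (hc a)) (f b) (hjoin a b hab).2
    have h2 := (hf a b).1.trans h1
    rw [hDC] at h2
    push_cast at h2
    have hm0 : (0 : ℝ) ≤ m := Nat.cast_nonneg m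
    have hk0 := abs_nonneg k
    have hk := le_abs_self k
    have h3 : (m + 1 : ℝ) * hammingDist a b ≤ (m + 1) * (24 * C + 6 * |k|) := by
      nlinarith [mul_nonneg hm0 hk0]
    have h4 := le_of_mul_le_mul_left h3 (by positivity)
    exact_mod_cast h4.trans (Nat.le_ceil _)
  omega

theorem asdimAN_eq_top_iff : asdimAN X = ⊤ ↔ ∀ n, ¬ AsdimANLE X n := by
  simp [asdimAN, iInf_eq_top]

theorem asdimANLE_zero_of_finite [Finite X] : AsdimANLE X 0 := by
  obtain ⟨K, hK⟩ := (Set.toFinite (Set.range fun p : X × X => nndist p.1 p.2)).bddAbove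
  -- A constant bound would suffice, but the slope must be positive.
  refine ⟨fun s => s + K, ⟨fun a b h => by dsimp only; gcongr,
    fun s _ => ⟨fun _ => Set.univ, Set.iUnion_const _, fun i x _ y _ z _ => ?_⟩⟩, 1, K, one_pos,
    fun s => by simp⟩
  have h : dist y z ≤ K := NNReal.coe_le_coe.mpr (hK ⟨(y, z), rfl⟩)
  push_cast
  linarith [s.coe_nonneg]

end AsymptoticDimension

/-! ### A digit-counting seminorm on `ℤ`. -/

section BlockSeminorm

/-- A seminorm on `ℤ` that detects the balanced ternary digits at the positions `m, …, 2 * m - 1`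
of an integer. -/
noncomputable def blockSeminorm (m : ℕ) (x : ℤ) : ℝ :=
  (m + 1) * ∑ i ∈ Finset.range m, ‖((x / 3 ^ (m + i + 1) : ℝ) : UnitAddCircle)‖

theorem UnitAddCircle.norm_coe_le_abs (x : ℝ) : ‖(x : UnitAddCircle)‖ ≤ |x| := by
  rw [UnitAddCircle.norm_eq]
  simpa using round_le x 0

theorem UnitAddCircle.norm_coe_intCast (x : ℤ) : ‖((x : ℝ) : UnitAddCircle)‖ = 0 := by
  simp [UnitAddCircle.norm_eq]

@[simp]
theorem blockSeminorm_zero (m : ℕ) : blockSeminorm m 0 = 0 := by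
  simp [blockSeminorm]

@[simp]
theorem blockSeminorm_neg (m : ℕ) (x : ℤ) : blockSeminorm m (-x) = blockSeminorm m x := by
  simp [blockSeminorm, neg_div]

theorem blockSeminorm_add_le (m : ℕ) (x y : ℤ) :
    blockSeminorm m (x + y) ≤ blockSeminorm m x + blockSeminorm m y := by
  rw [blockSeminorm, blockSeminorm, blockSeminorm, ← mul_add, ← Finset.sum_add_distrib]
  gcongr with i
  push_cast
  rw [add_div, AddCircle.coe_add]
  exact norm_add_le _ _

theorem sum_range_one_div_three_pow_le (M J : ℕ) :
    ∑ i ∈ Finset.range M, (if i < J then (0 : ℝ) else 1 / 3 ^ (i - J + 1)) ≤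
      (1 - 1 / 3 ^ (M - J)) / 2 := by
  induction M with
  | zero => simp
  | succ M ih =>
    rw [Finset.sum_range_succ]
    split_ifs with h
    · rw [show M + 1 - J = M - J by omega]
      linarith
    · rw [show M + 1 - J = M - J + 1 by omega]
      refine (add_le_add_left ih _).trans (le_of_eq ?_)
      field_simp
      ring

theorem blockSeminorm_le_mul_abs (m : ℕ) (x : ℤ) :
    blockSeminorm m x ≤ (m + 1) * (|(x : ℝ)| / 3 ^ m) := by
  have h := sum_range_one_div_three_pow_le m 0
  rw [blockSeminorm]
  gcongr
  calc ∑ i ∈ Finset.range m, ‖((x / 3 ^ (m + i + 1) : ℝ) : UnitAddCircle)‖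
      ≤ ∑ i ∈ Finset.range m, |(x : ℝ)| / 3 ^ m * (1 / 3 ^ (i + 1)) := by
        refine Finset.sum_le_sum fun i _ => (UnitAddCircle.norm_coe_le_abs _).trans (le_of_eq ?_)
        rw [abs_div, abs_of_pos (by positivity : (0 : ℝ) < 3 ^ (m + i + 1))]
        field_simp
        ring
    _ = |(x : ℝ)| / 3 ^ m * ∑ i ∈ Finset.range m, (1 : ℝ) / 3 ^ (i + 1) := by rw [Finset.mul_sum]
    _ ≤ |(x : ℝ)| / 3 ^ m * 1 := by
        gcongr
        refine le_trans ?_ (h.trans ?_)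
        · simp
        · have : (0 : ℝ) ≤ 1 / 3 ^ (m - 0) := by positivity
          linarith
    _ = _ := mul_one _

theorem succ_le_three_pow (m : ℕ) : (m + 1 : ℝ) ≤ 3 ^ m := by
  have := one_add_mul_le_pow (a := (2 : ℝ)) (by norm_num) m
  norm_num at this
  have : (0 : ℝ) ≤ m := Nat.cast_nonneg m
  linarith

theorem blockSeminorm_le_abs (m : ℕ) (x : ℤ) : blockSeminorm m x ≤ |(x : ℝ)| := by
  refine (blockSeminorm_le_mul_abs m x).trans ?_
  rw [mul_div_left_comm]
  exact mul_le_of_le_one_right (abs_nonneg _) ((div_le_one (by positivity)).mpr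
    (succ_le_three_pow m))

/-- For `j < m` the geometric decay `3 ^ (j - m)` absorbs the factor `m + 1`. For `j ≥ m` the terms
with `m + i + 1 ≤ j` are integers and vanish on the circle; the others sum to at most 1, and `m + 1
≤ j + 1`. -/
theorem blockSeminorm_three_pow_le (m j : ℕ) : blockSeminorm m (3 ^ j) ≤ j + 1 := by
  rcases lt_or_ge j m with h | h
  · refine (blockSeminorm_le_mul_abs m _).trans ?_
    obtain ⟨d, rfl⟩ := Nat.exists_eq_add_of_lt h
    have h1 := succ_le_three_pow (d + 1)
    push_cast at h1 ⊢
    rw [abs_of_pos (by positivity), show j + d + 1 = j + (d + 1) by ring, pow_add (3 : ℝ) j,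
      div_mul_cancel_left₀ (by positivity), ← div_eq_mul_inv, div_le_iff₀ (by positivity)]
    have hj : (0 : ℝ) ≤ j := Nat.cast_nonneg j
    have hd : (0 : ℝ) ≤ d := Nat.cast_nonneg d
    nlinarith [mul_nonneg hj hd]
  · have hsum : ∑ i ∈ Finset.range m, ‖(((3 ^ j : ℤ) / 3 ^ (m + i + 1) : ℝ) : UnitAddCircle)‖
        ≤ 1 := by
      refine (Finset.sum_le_sum fun i _ => ?_).trans
        ((sum_range_one_div_three_pow_le m (j - m)).trans ?_)
      · push_cast
        split_ifs with hi
        · rw [show (3 : ℝ) ^ j / 3 ^ (m + i + 1) = ((3 ^ (j - (m + i + 1)) : ℤ) : ℝ) by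
            push_cast
            rw [pow_sub₀ _ (by norm_num) (by omega), div_eq_mul_inv]]
          exact (UnitAddCircle.norm_coe_intCast _).le
        · refine (UnitAddCircle.norm_coe_le_abs _).trans (le_of_eq ?_)
          rw [abs_of_pos (by positivity), div_eq_div_iff (by positivity) (by positivity),
            ← pow_add, one_mul]
          congr 1
          omega
      · have : (0 : ℝ) ≤ 1 / 3 ^ (m - (j - m)) := by positivity
        linarith
    have hmj : (m : ℝ) ≤ j := Nat.cast_le.mpr h
    calc blockSeminorm m (3 ^ j) ≤ (m + 1) * 1 := by
          rw [blockSeminorm]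
          gcongr
      _ ≤ j + 1 := by linarith

theorem two_mul_abs_sum_three_pow_lt (δ : ℕ → ℤ) (hδ : ∀ i, |δ i| ≤ 1) (k : ℕ) :
    2 * |∑ i ∈ Finset.range k, δ i * 3 ^ i| < 3 ^ k := by
  induction k with
  | zero => simp
  | succ k ih =>
    rw [Finset.sum_range_succ]
    have h1 := abs_add_le (∑ i ∈ Finset.range k, δ i * 3 ^ i) (δ k * 3 ^ k)
    have h2 : |δ k * 3 ^ k| ≤ 3 ^ k := by
      rw [abs_mul, abs_of_pos (by positivity : (0 : ℤ) < 3 ^ k)]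
      exact mul_le_of_le_one_left (by positivity) (hδ k)
    rw [pow_succ]
    linarith

/-- Modulo 1, higher digits disappear and lower ones contribute `r` with `|r| < 3 ^ k / 2`. Hence
the fraction is represented by a number of absolute value between `1 / 6` and `1 / 2`, where the
circle norm is the absolute value. -/
theorem one_div_six_le_norm_of_digit_ne_zero (δ : ℕ → ℤ) (hδ : ∀ i, |δ i| ≤ 1) {m k : ℕ}
    (hk : k < m) (hk0 : δ k ≠ 0) :
    1 / 6 ≤ ‖(((∑ i ∈ Finset.range m, δ i * 3 ^ (m + i) : ℤ) / 3 ^ (m + k + 1) : ℝ) :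
      UnitAddCircle)‖ := by
  set r := ∑ i ∈ Finset.range k, δ i * 3 ^ i with hr
  have hrk : 2 * |r| < 3 ^ k := two_mul_abs_sum_three_pow_lt δ hδ k
  have hδk : |δ k| = 1 := le_antisymm (hδ k) (Int.one_le_abs hk0)
  obtain ⟨q, hq⟩ : ∃ q, ∑ i ∈ Finset.range m, δ i * 3 ^ (m + i) =
      3 ^ m * (r + δ k * 3 ^ k + 3 ^ (k + 1) * q) := by
    refine ⟨∑ i ∈ Finset.Ico (k + 1) m, δ i * 3 ^ (i - (k + 1)), ?_⟩
    rw [← Finset.sum_range_add_sum_Ico _ (Nat.succ_le_of_lt hk), Finset.sum_range_succ, hr,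
      mul_add, mul_add, Finset.mul_sum, Finset.mul_sum, Finset.mul_sum]
    congr 1
    · congr 1
      · exact Finset.sum_congr rfl fun i _ => by ring
      · ring
    · refine Finset.sum_congr rfl fun i hi => ?_
      obtain ⟨d, rfl⟩ := Nat.exists_eq_add_of_le (Finset.mem_Ico.mp hi).1
      rw [Nat.add_sub_cancel_left]
      ring
  have hval : ((∑ i ∈ Finset.range m, δ i * 3 ^ (m + i) : ℤ) / 3 ^ (m + k + 1) : ℝ) =
      ((r + δ k * 3 ^ k : ℤ) : ℝ) / 3 ^ (k + 1) + (q : ℤ) := by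
    rw [hq]
    push_cast
    field_simp
    ring
  have hlow : (3 : ℤ) ^ k ≤ 2 * |r + δ k * 3 ^ k| := by
    have h1 := abs_sub_abs_le_abs_sub (δ k * 3 ^ k) (-r)
    rw [abs_mul, hδk, abs_neg, one_mul, abs_of_pos (by positivity : (0 : ℤ) < 3 ^ k),
      sub_neg_eq_add, add_comm (δ k * 3 ^ k)] at h1
    linarith
  have hup : 2 * |r + δ k * 3 ^ k| ≤ (3 : ℤ) ^ (k + 1) := by
    have h1 := abs_add_le r (δ k * 3 ^ k)
    rw [abs_mul, hδk, one_mul, abs_of_pos (by positivity : (0 : ℤ) < 3 ^ k)] at h1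
    rw [pow_succ]
    linarith
  have hlow' : (3 : ℝ) ^ k ≤ 2 * |((r + δ k * 3 ^ k : ℤ) : ℝ)| := by exact_mod_cast hlow
  have hup' : 2 * |((r + δ k * 3 ^ k : ℤ) : ℝ)| ≤ (3 : ℝ) ^ (k + 1) := by exact_mod_cast hup
  have hpos : (0 : ℝ) < 3 ^ (k + 1) := by positivity
  have hzero : (((q : ℤ) : ℝ) : UnitAddCircle) = 0 :=
    norm_eq_zero.mp (UnitAddCircle.norm_coe_intCast q)
  rw [hval, AddCircle.coe_add, hzero, add_zero, (AddCircle.norm_coe_eq_abs_iff _ one_ne_zero).mpr]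
  · rw [abs_div, abs_of_pos hpos, div_le_div_iff₀ (by norm_num) hpos, pow_succ]
    linarith
  · rw [abs_div, abs_of_pos hpos, abs_one, div_le_div_iff₀ hpos (by norm_num)]
    linarith

theorem le_blockSeminorm_of_digits (δ : ℕ → ℤ) (hδ : ∀ i, |δ i| ≤ 1) (m : ℕ) :
    (m + 1 : ℝ) / 6 * (((Finset.range m).filter fun i => δ i ≠ 0).card : ℝ) ≤
      blockSeminorm m (∑ i ∈ Finset.range m, δ i * 3 ^ (m + i)) := by
  rw [blockSeminorm, div_mul_eq_mul_div, mul_div_assoc, Finset.cast_card, Finset.sum_filter,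
    Finset.sum_div]
  gcongr with k hk
  split_ifs with h
  · exact one_div_six_le_norm_of_digit_ne_zero δ hδ (Finset.mem_range.mp hk) h
  · simp

end BlockSeminorm

/-! ### The metric on `G` and its cubes. -/

section TernaryWeight

variable {G : Type*} [Group G]

open Classical in
/-- The weight on `G` giving `t ^ (±3 ^ j)` the weight `j + 1` and every other element a weight
that is at least its image under `φ : G →* ℤ`. -/
noncomputable def ternaryWeight (φ : G →* Multiplicative ℤ) (t : G) (e : G → ℕ) (g : G) : ℕ :=
  if g = t ^ (φ g).toAdd ∧ ∃ j, (φ g).toAdd.natAbs = 3 ^ j then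
    Nat.log 3 (φ g).toAdd.natAbs + 1
  -- `natAbs` dominates `blockSeminorm`, the injective `e` makes sublevel sets finite, `e g⁻¹` gives
  -- symmetry, and 1 gives positivity.
  else (φ g).toAdd.natAbs + e g + e g⁻¹ + 1

variable {φ : G →* Multiplicative ℤ} {t : G} {e : G → ℕ}

theorem ternaryWeight_pos (g : G) : 0 < ternaryWeight φ t e g := by
  rw [ternaryWeight]
  split_ifs <;> omega

theorem ternaryWeight_inv (g : G) : ternaryWeight φ t e g⁻¹ = ternaryWeight φ t e g := by
  have h : (φ g⁻¹).toAdd = -(φ g).toAdd := by simp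
  rw [ternaryWeight, ternaryWeight, h, inv_inv, Int.natAbs_neg, add_right_comm _ (e g⁻¹)]
  congr 1
  rw [zpow_neg, inv_inj]

theorem finite_setOf_ternaryWeight_le (he : Function.Injective e) (K : ℕ) :
    {g | ternaryWeight φ t e g ≤ K}.Finite := by
  refine (((Set.finite_Icc (-3 ^ K : ℤ) (3 ^ K)).image (fun x => t ^ x)).union
    ((Set.finite_Iic K).preimage he.injOn)).subset fun g hg => ?_
  rw [Set.mem_ofPred_eq, ternaryWeight] at hg
  split_ifs at hg with h
  · obtain ⟨hgt, j, hj⟩ := h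
    rw [hj, Nat.log_pow (by norm_num)] at hg
    refine Or.inl ⟨(φ g).toAdd, ?_, hgt.symm⟩
    have h1 : (3 : ℕ) ^ j ≤ 3 ^ K := Nat.pow_le_pow_right (by norm_num) (by omega)
    rw [← hj] at h1
    have h2 : |(φ g).toAdd| ≤ 3 ^ K := by
      rw [Int.abs_eq_natAbs]
      exact_mod_cast h1
    exact Set.mem_Icc.mpr (abs_le.mp h2)
  · refine Or.inr ?_
    simp only [Set.mem_preimage, Set.mem_Iic]
    omega

theorem blockSeminorm_le_ternaryWeight (m : ℕ) (g : G) :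
    blockSeminorm m (φ g).toAdd ≤ ternaryWeight φ t e g := by
  rw [ternaryWeight]
  split_ifs with h
  · obtain ⟨-, j, hj⟩ := h
    rw [hj, Nat.log_pow (by norm_num)]
    push_cast
    rcases Int.natAbs_eq (φ g).toAdd with h | h <;> rw [hj] at h <;> rw [h]
    · exact_mod_cast blockSeminorm_three_pow_le m j
    · rw [blockSeminorm_neg]
      exact_mod_cast blockSeminorm_three_pow_le m j
  · refine (blockSeminorm_le_abs m _).trans ?_
    rw [← Int.cast_abs, Int.abs_eq_natAbs, Int.cast_natCast]
    push_cast
    have h1 : (0 : ℝ) ≤ e g := Nat.cast_nonneg _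
    have h2 : (0 : ℝ) ≤ e g⁻¹ := Nat.cast_nonneg _
    linarith

theorem blockSeminorm_le_weightedLength (m : ℕ) (g : G) :
    blockSeminorm m (φ g).toAdd ≤ weightedLength (ternaryWeight φ t e) g :=
  le_weightedLength (F := fun g => blockSeminorm m (φ g).toAdd) (by simp)
    (fun g h => by simpa using blockSeminorm_add_le m _ _)
    (blockSeminorm_le_ternaryWeight m) g

theorem toAdd_map_zpow (ht : φ t = Multiplicative.ofAdd 1) (x : ℤ) : (φ (t ^ x)).toAdd = x := by
  simp [ht]

theorem weightedLength_zpow_digit_le (ht : φ t = Multiplicative.ofAdd 1) {δ : ℤ} (hδ : |δ| ≤ 1)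
    (j : ℕ) : weightedLength (ternaryWeight φ t e) (t ^ (δ * 3 ^ j)) ≤
      if δ ≠ 0 then j + 1 else 0 := by
  split_ifs with h
  · have habs : δ.natAbs = 1 := by
      have := abs_le.mp hδ
      omega
    refine (weightedLength_le _ _).trans (le_of_eq ?_)
    rw [ternaryWeight, toAdd_map_zpow ht, Int.natAbs_mul, habs, Int.natAbs_pow]
    have h3 : (3 : ℤ).natAbs = 3 := rfl
    simp [h3, Nat.log_pow]
  · rw [not_not.mp h]
    simp

theorem weightedLength_zpow_sum_le (ht : φ t = Multiplicative.ofAdd 1) (δ : ℕ → ℤ)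
    (hδ : ∀ i, |δ i| ≤ 1) (m : ℕ) (s : Finset ℕ) (hs : ∀ i ∈ s, i < m) :
    weightedLength (ternaryWeight φ t e) (t ^ (∑ i ∈ s, δ i * 3 ^ (m + i))) ≤
      2 * m * (s.filter fun i => δ i ≠ 0).card := by
  induction s using Finset.cons_induction with
  | empty => simp
  | cons a s ha ih =>
    rw [Finset.sum_cons, zpow_add, Finset.filter_cons]
    have h1 := ih fun i hi => hs i (Finset.mem_cons_of_mem hi)
    have h2 := weightedLength_zpow_digit_le (e := e) ht (hδ a) (m + a)
    have h3 := hs a (Finset.mem_cons_self a s)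
    refine (weightedLength_mul_le _ _ _).trans ?_
    split_ifs at h2 ⊢ with h
    -- Since `a < m`, the cost `m + a + 1` of a nonzero digit is at most `2 * m`.
    · rw [Finset.card_cons, mul_add]
      omega
    · omega

/-- The indicator function on `ℕ` of a vertex of the cube of dimension `m`. -/
def cubeDigit {m : ℕ} (a : Fin m → Bool) (i : ℕ) : ℤ :=
  if h : i < m then (if a ⟨i, h⟩ then 1 else 0) else 0

theorem abs_cubeDigit_sub_le {m : ℕ} (a b : Fin m → Bool) (i : ℕ) :
    |cubeDigit b i - cubeDigit a i| ≤ 1 := by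
  simp only [cubeDigit]
  split_ifs <;> simp

theorem card_cubeDigit_sub_ne_zero {m : ℕ} (a b : Fin m → Bool) :
    ((Finset.range m).filter fun i => cubeDigit b i - cubeDigit a i ≠ 0).card =
      hammingDist a b := by
  rw [hammingDist, Finset.card_filter, Finset.card_filter, Finset.sum_range]
  refine Finset.sum_congr rfl fun i _ => ?_
  simp only [cubeDigit, i.isLt, dif_pos]
  cases a i <;> cases b i <;> simp

theorem exists_properLeftInvariantMetric_asdimAN_eq_top [Countable G]
    (φ : G →* Multiplicative ℤ) (hφ : Function.Surjective φ) :
    ∃ _ : MetricSpace G, IsProperLeftInvariantMetric G ∧ asdimAN G = ⊤ := by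
  obtain ⟨t, ht⟩ := hφ (Multiplicative.ofAdd 1)
  obtain ⟨e, he⟩ := exists_injective_nat G
  refine ⟨weightedLengthMetric (ternaryWeight φ t e) ternaryWeight_inv ternaryWeight_pos,
    isProperLeftInvariantMetric_weightedLengthMetric _ _ (finite_setOf_ternaryWeight_le he), ?_⟩
  let _ := weightedLengthMetric (ternaryWeight φ t e) ternaryWeight_inv ternaryWeight_pos
  refine asdimAN_eq_top_iff.mpr (not_asdimANLE_of_cubes fun m => ?_)
  refine ⟨fun a => t ^ ∑ i ∈ Finset.range m, cubeDigit a i * 3 ^ (m + i), fun a b => ?_⟩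
  have hdist : dist (t ^ ∑ i ∈ Finset.range m, cubeDigit a i * 3 ^ (m + i))
      (t ^ ∑ i ∈ Finset.range m, cubeDigit b i * 3 ^ (m + i)) =
      (weightedLength (ternaryWeight φ t e) (t ^ ∑ i ∈ Finset.range m,
        (cubeDigit b i - cubeDigit a i) * 3 ^ (m + i)) : ℕ) := by
    change ((weightedLength _ _ : ℕ) : ℝ) = (weightedLength _ _ : ℕ)
    rw [← zpow_neg, ← zpow_add, neg_add_eq_sub, ← Finset.sum_sub_distrib]
    simp_rw [sub_mul]
  rw [hdist, ← card_cubeDigit_sub_ne_zero]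
  constructor
  · refine (le_blockSeminorm_of_digits _ (abs_cubeDigit_sub_le a b) m).trans ?_
    refine le_trans (le_of_eq ?_) (blockSeminorm_le_weightedLength (φ := φ) m _)
    rw [toAdd_map_zpow ht]
  · exact_mod_cast weightedLength_zpow_sum_le ht _ (abs_cubeDigit_sub_le a b) m
      (Finset.range m) fun i hi => Finset.mem_range.mp hi

end TernaryWeight

/-! ### The equivalence. -/

theorem corollary4p3 (G : Type*) [Group G] [Group.FG G] [Group.IsNilpotent G] :
    Infinite G ↔
      ∃ _ : MetricSpace G, IsProperLeftInvariantMetric G ∧ asdimAN G = ⊤ := by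
  constructor
  · intro _
    have := Group.FG.countable G
    obtain ⟨φ, hφ⟩ := Group.IsNilpotent.exists_surjective_int G
    exact exists_properLeftInvariantMetric_asdimAN_eq_top φ hφ
  · rintro ⟨_, -, h⟩
    by_contra hfin
    have := not_infinite_iff_finite.mp hfin
    exact asdimAN_eq_top_iff.mp h 0 asdimANLE_zero_of_finite
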